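/- Let $\Gamma=(G,\sigma)$ be a signed graph, that is, a finite simple graph $G$ together with a sign function $\sigma:E(G)\to\{+1,-1\}$. Its adjacency matrix $A(\Gamma)$ has $(u,v)$-entry $\sigma(uv)$ if $u$ and $v$ are adjacent and $0$ otherwise. The spectrum of $\Gamma$ (the eigenvalues of $A(\Gamma)$ with their multiplicities) is called symmetric if for each eigenvalue $\lambda$ of $A(\Gamma)$, $-\lambda$ is also an eigenvalue of $A(\Gamma)$ with the same multiplicity. Suppose that $G$ is unicyclic, that is, $G$ is connected and $|E(G)|=|V(G)|$ (so that $G$ has exactly one cycle). Then $\Gamma$ has a symmetric spectrum if and only if $G$ contains a cycle of even length; in other words, for the unique cycle $C$ of $G$, $\Gamma$ has a symmetric spectrum if and only if $C$ has even length. -/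

import Mathlib

/-- A signed graph `Γ = (G, σ)` on the vertex set `V`: a simple graph `G` (the underlying graph)
with a sign function `σ : E(G) → {+1, -1}`. -/
structure SignedGraph (V : Type*) where
  /-- the underlying graph -/
  graph : SimpleGraph V
  /-- the sign function -/
  sign : graph.edgeSet → ℤˣ

namespace SignedGraph

variable {V : Type*}

open Classical in
/-- The adjacency matrix `A(Γ)`: the entry at `(u, v)` is the sign of the edge `uv` if `u` and `v`
are adjacent, and `0` otherwise. -/
noncomputable def adjMatrix (Γ : SignedGraph V) : Matrix V V ℝ :=
  Matrix.of fun u v =>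
    if h : Γ.graph.Adj u v then ((Γ.sign ⟨s(u, v), h⟩ : ℤ) : ℝ) else 0

/-- The adjacency matrix is real symmetric, so all its eigenvalues are real and the multiset of
real roots of its characteristic polynomial is the full spectrum. -/
theorem adjMatrix_isHermitian (Γ : SignedGraph V) : Γ.adjMatrix.IsHermitian := by
  ext u v
  by_cases h : Γ.graph.Adj u v
  · have h2 : Γ.graph.Adj v u := h.symm
    have e : (⟨s(v, u), h2⟩ : Γ.graph.edgeSet) = ⟨s(u, v), h⟩ := Subtype.ext Sym2.eq_swap
    simp [adjMatrix, h, h2, e]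
  · have h2 : ¬ Γ.graph.Adj v u := fun k => h k.symm
    simp [adjMatrix, h, h2]

open Classical in
/-- The spectrum of `Γ`: the list of eigenvalues of `A(Γ)` with their multiplicities. -/
noncomputable def spec [Fintype V] (Γ : SignedGraph V) : Multiset ℝ :=
  Γ.adjMatrix.charpoly.roots

open Classical in
/-- `Γ` has a symmetric spectrum: for each eigenvalue `a` of `Γ`, also `-a` is an eigenvalue
of `Γ`, with the same multiplicity. -/
def HasSymmetricSpectrum [Fintype V] (Γ : SignedGraph V) : Prop :=
  ∀ a ∈ Γ.spec, -a ∈ Γ.spec ∧ Γ.spec.count (-a) = Γ.spec.count a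

end SignedGraph

/-- A graph (on a finite vertex set) is unicyclic if it is connected and has as many edges as
vertices. -/
def IsUnicyclic {V : Type*} (G : SimpleGraph V) : Prop :=
  G.Connected ∧ Nat.card G.edgeSet = Nat.card V

/-! Delete an edge `vw` of the cycle; a tree `T` remains, and on a tree every sign function is a
coboundary `t a * t b` (`IsAcyclic.exists_gauge`). Applied to the constant `-1`, this 2-colours `T`.
If the cycle is even, the colouring is proper on all of `G`, and conjugation by its diagonal matrix
turns `A` into `-A`. If it is odd, negating all signs changes the sign of the cycle, so one of `σ`,
`-σ` is a coboundary on `G` and `A` is similar to `±A(G)`. The trace of an odd power of `A` is then,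
up to sign, a number of closed walks, nonzero for the cycle length, whereas a symmetric spectrum
makes it vanish. -/

open SimpleGraph

/-! ### Coboundaries on forests and closed walks -/

namespace SimpleGraph

variable {V : Type*}

/-- On a forest, every symmetric sign function on pairs of vertices restricts on the edges to a
coboundary `a, b ↦ t a * t b`. -/
theorem IsAcyclic.exists_gauge [Finite V] {T : SimpleGraph V}
    (hT : T.IsAcyclic) (f : V → V → ℤˣ) (hf : ∀ a b, f a b = f b a) :
    ∃ t : V → ℤˣ, ∀ a b, T.Adj a b → f a b = t a * t b := by
  classical
  induction hn : Nat.card T.edgeSet using Nat.strong_induction_on generalizing T with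
  | _ n ih =>
  by_cases he : ∃ a b, T.Adj a b
  · obtain ⟨a, b, hab⟩ := he
    have hbr := isAcyclic_iff_forall_adj_isBridge.1 hT hab
    rw [isBridge_iff] at hbr
    set S := T.deleteEdges {s(a, b)} with hS
    have hlt : Nat.card S.edgeSet < n := by
      rw [← hn]
      refine Set.ncard_lt_ncard ?_ (Set.toFinite _)
      rw [edgeSet_ssubset_edgeSet]
      refine lt_of_le_of_ne (deleteEdges_le _) fun h => ?_
      exact hbr (by rw [h]; exact hab.reachable)
    obtain ⟨t, ht⟩ := ih _ hlt (hT.anti (deleteEdges_le _)) rfl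
    -- Rescaling `t` on the `a`-side of the bridge corrects the edge `ab`; an edge of `S` has both
    -- ends on one side, so its product is unchanged.
    refine ⟨fun x => if S.Reachable a x then t x * (f a b * t a * t b) else t x, fun x y hxy => ?_⟩
    have ha : S.Reachable a a := .refl a
    by_cases hs : s(x, y) = s(a, b)
    · have key : ∀ z p q : ℤˣ, z = p * (z * p * q) * q ∧ z = q * (p * (z * p * q)) := by decide
      rcases Sym2.eq_iff.1 hs with ⟨rfl, rfl⟩ | ⟨rfl, rfl⟩
      · simpa only [ha, hbr, if_true, if_false] using (key _ _ _).1
      · simpa only [ha, hbr, if_true, if_false, hf x y] using (key _ _ _).2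
    · have hS' : S.Adj x y := by simp [hS, hs, hxy]
      have : S.Reachable a x ↔ S.Reachable a y :=
        ⟨fun h => h.trans hS'.reachable, fun h => h.trans hS'.symm.reachable⟩
      rw [ht x y hS']
      simp only [this]
      split_ifs
      · rw [mul_mul_mul_comm, Int.units_mul_self, mul_one]
      · rfl
  · push Not at he
    exact ⟨1, fun a b h => (he a b h).elim⟩

theorem Walk.mul_eq_neg_one_pow_length {G : SimpleGraph V} {c : V → ℤˣ}
    (hc : ∀ a b, G.Adj a b → -1 = c a * c b) {u v : V} (p : G.Walk u v) :
    c u * c v = (-1) ^ p.length := by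
  induction p with
  | nil => simp
  | @cons a b d h p ih =>
    have key : ∀ x y z w : ℤˣ, -1 = x * y → y * z = w → x * z = w * -1 := by decide
    rw [Walk.length_cons, pow_succ]
    exact key _ _ _ _ (hc _ _ h) ih

theorem trace_adjMatrix_pow_pos [Fintype V] [DecidableEq V] (G : SimpleGraph V)
    [DecidableRel G.Adj] {v : V} (c : G.Walk v v) :
    0 < (G.adjMatrix ℝ ^ c.length).trace := by
  simp only [Matrix.trace, Matrix.diag_apply, adjMatrix_pow_apply_eq_card_walk]
  refine Finset.sum_pos' (fun _ _ => Nat.cast_nonneg _) ⟨v, Finset.mem_univ _, ?_⟩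
  rw [Nat.cast_pos, Fintype.card_pos_iff]
  exact ⟨⟨c, rfl⟩⟩

end SimpleGraph

/-! ### Conjugation by sign matrices; spectrum of `-A` -/

namespace Matrix

variable {n : Type*} [Fintype n] [DecidableEq n]

theorem eq_units_conj_of_gauge {R : Type*} [CommRing R] {A M : Matrix n n R} {t : n → ℤˣ}
    (h : ∀ i j, A i j = ((t i : ℤ) : R) * M i j * ((t j : ℤ) : R)) :
    ∃ u : (Matrix n n R)ˣ, A = u.val * M * u⁻¹.val := by
  set D : Matrix n n R := diagonal fun i => ((t i : ℤ) : R)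
  have hD : D * D = 1 := by
    simp only [D, diagonal_mul_diagonal, ← Int.cast_mul, ← Units.val_mul, Int.units_mul_self]
    simp
  refine ⟨⟨D, D, hD, hD⟩, ?_⟩
  ext i j
  simp [D, h]

theorem trace_pow_eq_of_gauge {R : Type*} [CommRing R] {A M : Matrix n n R} {t : n → ℤˣ}
    (h : ∀ i j, A i j = ((t i : ℤ) : R) * M i j * ((t j : ℤ) : R)) (k : ℕ) :
    (A ^ k).trace = (M ^ k).trace := by
  obtain ⟨u, rfl⟩ := eq_units_conj_of_gauge h
  rw [Units.conj_pow, trace_mul_comm, ← mul_assoc, Units.inv_mul, one_mul]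

theorem charpoly_eq_of_gauge {R : Type*} [CommRing R] {A M : Matrix n n R} {t : n → ℤˣ}
    (h : ∀ i j, A i j = ((t i : ℤ) : R) * M i j * ((t j : ℤ) : R)) :
    A.charpoly = M.charpoly := by
  obtain ⟨u, rfl⟩ := eq_units_conj_of_gauge h
  rw [charpoly_mul_comm, ← mul_assoc, Units.inv_mul, one_mul]

open Polynomial in
theorem charpoly_neg_eq {R : Type*} [CommRing R] (A : Matrix n n R) :
    (-A).charpoly = (-1) ^ Fintype.card n * A.charpoly.comp (-X) := by
  have : A.charpoly.comp (-X) = (-charmatrix (-A)).det := by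
    rw [charpoly, ← coe_compRingHom_apply, RingHom.map_det]
    congr 1
    ext i j : 2
    by_cases hij : i = j
    · subst hij; simp; ring
    · simp [hij]
  rw [this, det_neg, ← mul_assoc, ← mul_pow, charpoly]
  simp

theorem roots_charpoly_neg {R : Type*} [CommRing R] [IsDomain R] (A : Matrix n n R) :
    (-A).charpoly.roots = A.charpoly.roots.map fun x => -x := by
  rw [charpoly_neg_eq, ← Polynomial.roots_comp_neg_X]
  rcases neg_one_pow_eq_or (Polynomial R) (Fintype.card n) with h | h <;> simp [h]

theorem IsHermitian.trace_pow_eq_sum_roots {A : Matrix n n ℝ} (hA : A.IsHermitian) (k : ℕ) :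
    (A ^ k).trace = (A.charpoly.roots.map (· ^ k)).sum := by
  rw [hA.roots_charpoly_eq_eigenvalues]
  conv_lhs => rw [hA.spectral_theorem, ← map_pow, Unitary.conjStarAlgAut_apply, trace_mul_comm,
    ← mul_assoc]
  simp [diagonal_pow, trace_diagonal]

end Matrix

/-! ### Even and odd cycles -/

namespace SignedGraph

variable {V : Type*}

open Classical in
theorem HasSymmetricSpectrum.trace_pow_eq_zero [Fintype V] {Γ : SignedGraph V} (h : Γ.HasSymmetricSpectrum)
    {k : ℕ} (hk : Odd k) : (Γ.adjMatrix ^ k).trace = 0 := by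
  have hs : Γ.spec.map (fun x => -x) = Γ.spec := by
    ext a
    have h1 : (Γ.spec.map fun x => -x).count a = Γ.spec.count (-a) := by
      conv_lhs => rw [← neg_neg a]
      exact Multiset.count_map_eq_count' _ _ neg_injective _
    rw [h1]
    -- The definition constrains eigenvalues only; for other `a`, it is applied to `-a`.
    by_cases ha : a ∈ Γ.spec
    · exact (h a ha).2
    · rw [Multiset.count_eq_zero_of_notMem ha, Multiset.count_eq_zero]
      intro hn
      exact ha (by simpa using (h _ hn).1)
  have ht : (Γ.adjMatrix ^ k).trace = (Γ.spec.map (· ^ k)).sum :=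
    Γ.adjMatrix_isHermitian.trace_pow_eq_sum_roots k
  have : (Γ.spec.map (· ^ k)).sum = -(Γ.spec.map (· ^ k)).sum := by
    conv_lhs => rw [← hs]
    simp [Multiset.map_map, hk.neg_pow]
  linarith

open Classical in
theorem hasSymmetricSpectrum_of_charpoly_neg [Fintype V] {Γ : SignedGraph V}
    (h : Γ.adjMatrix.charpoly = (-Γ.adjMatrix).charpoly) : Γ.HasSymmetricSpectrum := by
  have hs : Γ.spec.map (fun x => -x) = Γ.spec := by
    rw [spec, ← Matrix.roots_charpoly_neg, ← h]
  have hc (a : ℝ) : Γ.spec.count (-a) = Γ.spec.count a := by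
    conv_lhs => rw [← hs]
    exact Multiset.count_map_eq_count' _ _ neg_injective _
  exact fun a ha => ⟨Multiset.count_pos.1 (hc a ▸ Multiset.count_pos.2 ha), hc a⟩

open Classical in
/-- The sign function of a signed graph, extended by `1` to nonadjacent pairs. -/
noncomputable def signExt (Γ : SignedGraph V) (a b : V) : ℤˣ :=
  if h : Γ.graph.Adj a b then Γ.sign ⟨s(a, b), h⟩ else 1

theorem signExt_comm (Γ : SignedGraph V) (a b : V) : Γ.signExt a b = Γ.signExt b a := by
  by_cases h : Γ.graph.Adj a b
  · have e : (⟨s(a, b), h⟩ : Γ.graph.edgeSet) = ⟨s(b, a), h.symm⟩ := Subtype.ext Sym2.eq_swap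
    simp [signExt, h, h.symm, e]
  · have h2 : ¬ Γ.graph.Adj b a := fun k => h k.symm
    simp [signExt, h, h2]

open Classical in
theorem adjMatrix_apply_eq (Γ : SignedGraph V) (a b : V) :
    Γ.adjMatrix a b = ((Γ.signExt a b : ℤ) : ℝ) * Γ.graph.adjMatrix ℝ a b := by
  by_cases h : Γ.graph.Adj a b <;> simp [adjMatrix, signExt, h]

/-- A signed graph whose underlying graph is bipartite has a symmetric spectrum. -/
theorem hasSymmetricSpectrum_of_coloring [Fintype V] {Γ : SignedGraph V} {c : V → ℤˣ}
    (hc : ∀ a b, Γ.graph.Adj a b → -1 = c a * c b) : Γ.HasSymmetricSpectrum := by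
  classical
  apply hasSymmetricSpectrum_of_charpoly_neg
  refine (Matrix.charpoly_eq_of_gauge (t := c) fun a b => ?_)
  by_cases h : Γ.graph.Adj a b
  · have : ((c a : ℤ) : ℝ) * ((c b : ℤ) : ℝ) = -1 := by
      rw [← Int.cast_mul, ← Units.val_mul, ← hc a b h]; simp
    rw [Matrix.neg_apply]
    linear_combination (-Γ.adjMatrix a b) * -this
  · simp [adjMatrix, h]

/-- A signed graph that is, up to a global sign, switching equivalent to its underlying graph, and
has a closed walk of odd length, does not have a symmetric spectrum. -/
theorem not_hasSymmetricSpectrum_of_gauge [Fintype V] {Γ : SignedGraph V} {t : V → ℤˣ} {e : ℤˣ}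
    (ht : ∀ a b, Γ.graph.Adj a b → Γ.signExt a b = e * (t a * t b)) {v : V}
    (c : Γ.graph.Walk v v) (hc : Odd c.length) : ¬ Γ.HasSymmetricSpectrum := by
  classical
  intro hs
  have h0 := hs.trace_pow_eq_zero hc
  rw [Matrix.trace_pow_eq_of_gauge (t := t) (M := ((e : ℤ) : ℝ) • Γ.graph.adjMatrix ℝ), smul_pow,
    Matrix.trace_smul, smul_eq_mul] at h0
  · have := Γ.graph.trace_adjMatrix_pow_pos c
    rcases Int.units_eq_one_or e with rfl | rfl
    · simp at h0
      exact this.ne' h0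
    · simp at h0
      exact this.ne' h0
  · intro a b
    rw [adjMatrix_apply_eq]
    by_cases h : Γ.graph.Adj a b
    · rw [ht a b h]
      simp [h]
      ring
    · simp [h]

theorem hasSymmetricSpectrum_iff_even [Fintype V] {Γ : SignedGraph V} (hG : IsUnicyclic Γ.graph) {v : V}
    (c : Γ.graph.Walk v v) (hc : c.IsCycle) : Γ.HasSymmetricSpectrum ↔ Even c.length := by
  classical
  cases c with
  | nil => exact (hc.ne_nil rfl).elim
  | @cons _ w _ h p =>
  obtain ⟨-, hp⟩ := (Walk.cons_isCycle_iff p h).1 hc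
  set T := Γ.graph.deleteEdges {s(v, w)} with hTdef
  have hbr : ¬ Γ.graph.IsBridge s(v, w) := fun hb =>
    hb.notMem_edges_of_isCycle hc (by simp)
  have hadj : ∀ a b, Γ.graph.Adj a b → T.Adj a b ∨ s(a, b) = s(v, w) := fun a b hab => by
    simp only [hTdef, deleteEdges_adj, Set.mem_singleton_iff]
    tauto
  have hT : T.IsTree := by
    rw [isTree_iff_connected_and_card]
    refine ⟨hG.1.connected_delete_edge_of_not_isBridge hbr, ?_⟩
    rw [← hG.2, hTdef, edgeSet_deleteEdges]
    exact Set.ncard_sdiff_singleton_add_one (by simpa using h) (Set.toFinite _)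
  obtain ⟨k, hk⟩ := hT.isAcyclic.exists_gauge (fun _ _ => -1) fun _ _ => rfl
  have hkp : k w * k v = (-1) ^ p.length := by
    have := Walk.mul_eq_neg_one_pow_length hk (p.toDeleteEdge _ hp)
    rwa [Walk.length_transfer] at this
  rw [Walk.length_cons]
  by_cases hpar : Even p.length
  · have hodd : Odd (p.length + 1) := hpar.add_one
    refine iff_of_false ?_ (Nat.not_even_iff_odd.2 hodd)
    rw [hpar.neg_one_pow] at hkp
    obtain ⟨t, ht⟩ := hT.isAcyclic.exists_gauge Γ.signExt Γ.signExt_comm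
    have main : ∃ (t : V → ℤˣ) (e : ℤˣ), (∀ a b, T.Adj a b → Γ.signExt a b = e * (t a * t b)) ∧
        Γ.signExt v w = e * (t v * t w) := by
      by_cases hvw : Γ.signExt v w = t v * t w
      · exact ⟨t, 1, by simpa using ht, by simpa using hvw⟩
      -- On tree edges `k` contributes `-1`, cancelled by `e = -1`. On `vw` it contributes `1`, as
      -- `p` is even, so there `e` supplies the missing sign.
      · refine ⟨fun x => t x * k x, -1, fun a b hab => ?_, ?_⟩
        · have key : ∀ s a b c d : ℤˣ, s = a * b → -1 = c * d → s = -1 * (a * c * (b * d)) := by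
            decide
          exact key _ _ _ _ _ (ht a b hab) (hk a b hab)
        · have key : ∀ s a b c d : ℤˣ, s ≠ a * b → d * c = 1 → s = -1 * (a * c * (b * d)) := by
            decide
          exact key _ _ _ _ _ hvw hkp
    obtain ⟨t, e, h1, h2⟩ := main
    refine not_hasSymmetricSpectrum_of_gauge (t := t) (e := e) (fun a b hab => ?_) (.cons h p)
      (by simpa using hodd)
    rcases hadj a b hab with h' | h'
    · exact h1 a b h'
    · rcases Sym2.eq_iff.1 h' with ⟨rfl, rfl⟩ | ⟨rfl, rfl⟩
      · exact h2
      · rw [signExt_comm, h2, mul_comm (t b)]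
  · refine iff_of_true ?_ (Nat.not_even_iff_odd.1 hpar).add_one
    rw [(Nat.not_even_iff_odd.1 hpar).neg_one_pow] at hkp
    -- As `p` is odd, `k` also separates the ends of the deleted edge.
    refine hasSymmetricSpectrum_of_coloring (c := k) fun a b hab => ?_
    rcases hadj a b hab with h' | h'
    · exact hk a b h'
    · rcases Sym2.eq_iff.1 h' with ⟨rfl, rfl⟩ | ⟨rfl, rfl⟩
      · rw [← hkp, mul_comm]
      · exact hkp.symm

end SignedGraph

theorem IsUnicyclic.exists_isCycle {V : Type*} [Finite V] {G : SimpleGraph V}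
    (hG : IsUnicyclic G) : ∃ (v : V) (c : G.Walk v v), c.IsCycle := by
  by_contra! hn
  have hT : G.IsTree := ⟨hG.1, fun v c => hn v c⟩
  have h1 := (isTree_iff_connected_and_card.1 hT).2
  have h2 := hG.2
  omega

theorem mainTheorem9 {V : Type*} [Fintype V] (Γ : SignedGraph V) (hG : IsUnicyclic Γ.graph) :
    (Γ.HasSymmetricSpectrum ↔
      ∃ (v : V) (c : Γ.graph.Walk v v), c.IsCycle ∧ Even c.length) ∧
    (∀ (v : V) (c : Γ.graph.Walk v v), c.IsCycle →
      (Γ.HasSymmetricSpectrum ↔ Even c.length)) := by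
  refine ⟨⟨fun h => ?_, ?_⟩, fun v c hc => SignedGraph.hasSymmetricSpectrum_iff_even hG c hc⟩
  · obtain ⟨v, c, hc⟩ := hG.exists_isCycle
    exact ⟨v, c, hc, (SignedGraph.hasSymmetricSpectrum_iff_even hG c hc).1 h⟩
  · rintro ⟨v, c, hc, he⟩
    exact (SignedGraph.hasSymmetricSpectrum_iff_even hG c hc).2 he
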